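/- Let $Z:[0,S]\to\mathbb C$ ($S>0$) be a plane arc parametrized by arc length, with signed curvature $k$ on $(0,S)$ and continuous tangent angle $\tau$, i.e. $\tau(s)=\tau(0)+\int_0^s k$ and $Z(s)=Z(0)+\int_0^s e^{i\tau(\sigma)}\,d\sigma$. Suppose that it is a spiral: $k$ is monotonic (non-strictly, but not constant), piecewise continuous and integrable on $(0,S)$ (it may change sign, and it may be unbounded near $0$ and near $S$), and the curve does not contain the whole circumference of a circle. Let $\rho=\tau(S)-\tau(0)=\int_0^S k(s)\,ds$ be its winding angle. There is a continuous function $\tilde\mu(u,v)$ on $\{0\le u\le v\le S\}$ such that $\tilde\mu(u,u)=\tau(u)$ for all $u$ and $Z(v)-Z(u)=|Z(v)-Z(u)|\,e^{i\tilde\mu(u,v)}$ for all $u<v$, and the value $\tilde\mu(0,S)$ is the same for all such functions. Let $\tilde\alpha=\tau(0)-\tilde\mu(0,S)$ and $\tilde\beta=\tau(S)-\tilde\mu(0,S)$ be the cumulative boundary angles and $\tilde\omega=\tfrac12(\tilde\alpha+\tilde\beta)$ Vogt's angle of the spiral. Then $$|\rho|<2|\tilde\omega|+2\pi .$$ If the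 spiral has no inflection (i.e. $k$ does not take both positive and negative values on $(0,S)$), then $$0<2|\tilde\omega|<|\rho|<2|\tilde\omega|+2\pi .$$ -/

import Mathlib

/-- A plane arc given by its intrinsic equation `k = k(s)`, `0 ≤ s ≤ S` (`s` is arc length and `k`
the signed curvature), together with its start point and the direction angle of its tangent
there. Only the values of `curvature` on the open interval `(0, S)` matter. -/
structure PlaneArc where
  /-- the total length `S` -/
  length : ℝ
  length_pos : 0 < length
  /-- the signed curvature `k` as a function of arc length -/
  curvature : ℝ → ℝ
  /-- the start point `Z(0)` -/
  startPoint : ℂ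
  /-- the tangent angle `τ(0)` at the start point -/
  startAngle : ℝ

namespace PlaneArc

/-- The (continuous) tangent angle `τ(s) = τ(0) + ∫₀ˢ k`. -/
noncomputable def tangentAngle (A : PlaneArc) (s : ℝ) : ℝ :=
  A.startAngle + ∫ t in (0 : ℝ)..s, A.curvature t

/-- The point `Z(s) = Z(0) + ∫₀ˢ exp(i τ)` of the plane, identified with `ℂ`. -/
noncomputable def point (A : PlaneArc) (s : ℝ) : ℂ :=
  A.startPoint + ∫ t in (0 : ℝ)..s, Complex.exp ((A.tangentAngle t : ℂ) * Complex.I)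

/-- The winding angle `ρ = τ(S) - τ(0) = ∫₀ˢ k`, with `S` the total length. -/
noncomputable def windingAngle (A : PlaneArc) : ℝ :=
  ∫ t in (0 : ℝ)..A.length, A.curvature t

/-- A spiral: the curvature is monotonic (in the non-strict sense, but not constant), piecewise
continuous, and the curve does not contain the circumference of a circle. The curvature may change
sign, and it may be infinite at the endpoints, i.e. unbounded near `0` and near `S`; it is
integrable, so that the tangent angle is defined and continuous up to the endpoints. -/
structure IsSpiral (A : PlaneArc) : Prop where
  monotonic : MonotoneOn A.curvature (Set.Ioo 0 A.length) ∨
    AntitoneOn A.curvature (Set.Ioo 0 A.length)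
  nonconstant : ∃ s ∈ Set.Ioo 0 A.length, ∃ t ∈ Set.Ioo 0 A.length,
    A.curvature s ≠ A.curvature t
  piecewise_continuous : ∃ F : Set ℝ, F.Finite ∧
    ContinuousOn A.curvature (Set.Ioo 0 A.length \ F)
  integrable : IntervalIntegrable A.curvature MeasureTheory.volume 0 A.length
  no_circle : ∀ (c : ℂ) (r : ℝ), 0 < r →
    ¬ Metric.sphere c r ⊆ A.point '' Set.Icc 0 A.length

/-- The arc has an inflection: its curvature changes sign. (For a spiral the inflection points
are then the inner points of zero curvature or, if there are none, the point where the curvature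
jumps from one sign to the other.) -/
def HasInflection (A : PlaneArc) : Prop :=
  ∃ s ∈ Set.Ioo 0 A.length, ∃ t ∈ Set.Ioo 0 A.length,
    A.curvature s < 0 ∧ 0 < A.curvature t

/-- The pairs `(u, v)` with `0 ≤ u ≤ v ≤ S`, which parametrize the subarcs of the arc. -/
def subarcs (A : PlaneArc) : Set (ℝ × ℝ) :=
  {p | 0 ≤ p.1 ∧ p.1 ≤ p.2 ∧ p.2 ≤ A.length}

/-- `m` is the cumulative chord direction: `m (u, v)` is, for `u < v`, an argument of the chord
`Z(v) - Z(u)`, it depends continuously on `(u, v)`, also as the subarc shrinks to a point, and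
`m (u, u)` is the tangent angle `τ(u)`. -/
structure IsCumulativeChordAngle (A : PlaneArc) (m : ℝ × ℝ → ℝ) : Prop where
  continuousOn : ContinuousOn m A.subarcs
  diag : ∀ u ∈ Set.Icc 0 A.length, m (u, u) = A.tangentAngle u
  chord : ∀ u v : ℝ, 0 ≤ u → u < v → v ≤ A.length →
    A.point v - A.point u =
      (‖A.point v - A.point u‖ : ℂ) * Complex.exp ((m (u, v) : ℂ) * Complex.I)

/-- `w` is Vogt's angle of the arc: half the sum of the cumulative boundary angles
`τ(0) - m (0, S)` and `τ(S) - m (0, S)` of the whole arc, where `m` is the cumulative chord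
direction. -/
def IsVogtAngle (A : PlaneArc) (w : ℝ) : Prop :=
  ∃ m : ℝ × ℝ → ℝ, A.IsCumulativeChordAngle m ∧
    w = ((A.tangentAngle 0 - m (0, A.length)) +
      (A.tangentAngle A.length - m (0, A.length))) / 2

end PlaneArc

/-! Write `α`, `β` for the cumulative boundary angles. Then `ρ = β - α` and `2ω = α + β`, so when `ω
> 0` the bound `|ρ| < 2|ω| + 2π` says exactly that `α > -π` and `β > -π`, while `2|ω| < |ρ|` says
that one of `α`, `β` is negative. Reflection in the real axis reduces everything to increasing
curvature, where `ω > 0` is Vogt's theorem.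

Fix an end `b` and split the chord `Z b - Z x` into components `T`, `N` along the tangent and the
left normal at `x`. Then `T = -(|Z b - Z x|²/2)'` and `N' = -k T`, hence `∫ (k - c) T` over `[u, b]`
equals `N(u) - c |Z b - Z u|²/2`. All tail integrals of `T` are nonnegative, so the rearrangement
inequality makes this nonnegative when `k` is increasing and at least `c` (`le_normal`), with a
strict version `lt_normal`.

This comparison does all the work. A loop must have constant curvature, hence contain a circle, so a
spiral is injective and its chords have continuous directions. The direction `w` of the chord from
`Z u` to the end of the arc has derivative `N / |chord|²`. Comparison with `c = k u` makes `τ - 2w`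
decrease, which gives `α + β > 0`; comparison with `c = 0` controls the sign of `sin (τ - w)`, which
gives `α > -π`, and `α < 0` if `k ≥ 0`. Running the arc backwards gives the statements about `β`. -/

open MeasureTheory Set

/-! ### Rearrangement by the layer-cake formula -/

/-- Rearrangement inequality: a nonnegative increasing weight, integrated against a function whose
tail integrals are nonnegative, gives at least its value at `x` times a lower bound for the tail
integrals that start to the left of `x`. -/
theorem mul_le_integral_mul_of_monotoneOn {a b x m : ℝ} {k p : ℝ → ℝ} (hx : x ∈ Ioo a b)
    (hk : MonotoneOn k (Ioo a b)) (hk0 : ∀ t ∈ Ioo a b, 0 ≤ k t)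
    (hki : IntervalIntegrable k volume a b) (hp : Continuous p)
    (hQ : ∀ y ∈ Icc a b, 0 ≤ ∫ t in y..b, p t) (hm : 0 ≤ m)
    (hQm : ∀ y ∈ Icc a x, m ≤ ∫ t in y..b, p t) :
    m * k x ≤ ∫ t in a..b, k t * p t := by
  have hab : a ≤ b := (hx.1.trans hx.2).le
  set k₁ : ℝ → ℝ := (Ioo a b).indicator k with hk₁
  have hk₁0 : ∀ t, 0 ≤ k₁ t := fun t => indicator_nonneg hk0 t
  have hk₁eq : ∀ t ∈ Ioo a b, k₁ t = k t := fun t ht => indicator_of_mem ht k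
  have hmem : ∀ s, 0 ≤ s → ∀ t, s < k₁ t → t ∈ Ioo a b := by
    intro s hs t ht
    by_contra h
    rw [hk₁, indicator_of_notMem h] at ht
    exact absurd ht (not_lt.2 hs)
  have hup : ∀ s, 0 ≤ s → ∀ t, s < k₁ t → ∀ t' ∈ Ico t b, s < k₁ t' := by
    intro s hs t ht t' ht'
    have h1 := hmem s hs t ht
    have h2 : t' ∈ Ioo a b := ⟨h1.1.trans_le ht'.1, ht'.2⟩
    rw [hk₁eq t' h2]
    rw [hk₁eq t h1] at ht
    exact ht.trans_le (hk h1 h2 ht'.1)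
  have hmeasS : ∀ s, MeasurableSet {t | s < k₁ t} := by
    intro s
    rcases lt_or_ge s 0 with hs | hs
    · convert MeasurableSet.univ
      exact eq_univ_of_forall fun t => hs.trans_le (hk₁0 t)
    · refine OrdConnected.measurableSet ⟨fun t ht t' ht' z hz => ?_⟩
      exact hup s hs t ht z ⟨hz.1, hz.2.trans_lt (hmem s hs t' ht').2⟩
  have hmeas : Measurable k₁ := measurable_of_Ioi fun s => hmeasS s
  -- By monotonicity a superlevel set of `k₁` is a tail of `(a, b)`, up to its left endpoint `y`.
  have hae : ∀ s, 0 ≤ s → {t | s < k₁ t}.Nonempty → ∃ y ∈ Ico a b,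
      ({t | s < k₁ t} =ᵐ[volume] Ioo y b) ∧ ∀ t, s < k₁ t → y ≤ t := by
    intro s hs hne
    have hbdd : BddBelow {t | s < k₁ t} := ⟨a, fun t ht => (hmem s hs t ht).1.le⟩
    obtain ⟨t₀, ht₀⟩ := hne
    refine ⟨sInf {t | s < k₁ t}, ⟨le_csInf ⟨t₀, ht₀⟩ fun t ht => (hmem s hs t ht).1.le,
      (csInf_le hbdd ht₀).trans_lt (hmem s hs t₀ ht₀).2⟩, ?_, fun t ht => csInf_le hbdd ht⟩
    have hsub : Ioo (sInf {t | s < k₁ t}) b ⊆ {t | s < k₁ t} := by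
      intro t ht
      obtain ⟨t', ht', hlt⟩ := exists_lt_of_csInf_lt ⟨t₀, ht₀⟩ ht.1
      exact hup s hs t' ht' t ⟨hlt.le, ht.2⟩
    have hsub' : {t | s < k₁ t} ⊆ Ico (sInf {t | s < k₁ t}) b := fun t ht =>
      ⟨csInf_le hbdd ht, (hmem s hs t ht).2⟩
    exact (hsub'.eventuallyLE.trans Ioo_ae_eq_Ico.symm.le).antisymm hsub.eventuallyLE
  have key : ∀ y ∈ Icc a b, ∀ c, 0 ≤ c → c ≤ ∫ t in y..b, p t →
      (∫⁻ t in Ioo y b, ENNReal.ofReal (-p t)) + ENNReal.ofReal c ≤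
        ∫⁻ t in Ioo y b, ENNReal.ofReal (p t) := by
    intro y hy c hc0 hc
    have hint : IntegrableOn p (Ioo y b) :=
      (hp.integrableOn_Icc (a := y) (b := b)).mono_set Ioo_subset_Icc_self
    have hn : (∫⁻ t in Ioo y b, ENNReal.ofReal (-p t)) ≠ ⊤ := hint.neg.lintegral_lt_top.ne
    have hp' : (∫⁻ t in Ioo y b, ENNReal.ofReal (p t)) ≠ ⊤ := hint.lintegral_lt_top.ne
    rw [intervalIntegral.integral_of_le hy.2, integral_Ioc_eq_integral_Ioo,
      integral_eq_lintegral_pos_part_sub_lintegral_neg_part hint] at hc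
    rw [← ENNReal.toReal_le_toReal (by simp [hn]) hp', ENNReal.toReal_add hn (by simp),
      ENNReal.toReal_ofReal hc0]
    linarith
  -- For a level `s < k x` the point `x` lies in the superlevel set, so the tail starts at `y ≤ x`
  -- and the bound `m` applies. Integrating over `s` then yields `m * k x`.
  have hlevel : ∀ s, 0 < s →
      (volume.withDensity fun t => ENNReal.ofReal (-p t)) {t | s < k₁ t} +
        (Iio (k x)).indicator (fun _ => ENNReal.ofReal m) s ≤
      (volume.withDensity fun t => ENNReal.ofReal (p t)) {t | s < k₁ t} := by
    intro s hs
    rw [withDensity_apply _ (hmeasS s), withDensity_apply _ (hmeasS s)]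
    by_cases hne : {t | s < k₁ t}.Nonempty
    · obtain ⟨y, hy, hy1, hy2⟩ := hae s hs.le hne
      rw [Measure.restrict_congr_set hy1]
      by_cases hsx : s < k x
      · rw [indicator_of_mem (show s ∈ Iio (k x) from hsx)]
        exact key y ⟨hy.1, hy.2.le⟩ m hm (hQm y ⟨hy.1, hy2 x (by rwa [hk₁eq x hx])⟩)
      · rw [indicator_of_notMem (by simpa using hsx)]
        simpa using key y ⟨hy.1, hy.2.le⟩ 0 le_rfl (hQ y ⟨hy.1, hy.2.le⟩)
    · rw [not_nonempty_iff_eq_empty.1 hne, indicator_of_notMem]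
      · simp
      · intro h
        exact hne ⟨x, by simpa [hk₁eq x hx] using h⟩
  have hlay : ∀ q : ℝ → ℝ, Measurable q →
      ∫⁻ t, ENNReal.ofReal (k₁ t) * ENNReal.ofReal (q t) =
        ∫⁻ s in Ioi 0, (volume.withDensity fun t => ENNReal.ofReal (q t)) {t | s < k₁ t} := by
    intro q hq
    rw [← lintegral_eq_lintegral_meas_lt _ (ae_of_all _ hk₁0) hmeas.aemeasurable,
      lintegral_withDensity_eq_lintegral_mul _ hq.ennreal_ofReal hmeas.ennreal_ofReal]
    simp [mul_comm]
  have hsum : (∫⁻ t, ENNReal.ofReal (k₁ t) * ENNReal.ofReal (-p t)) + ENNReal.ofReal (m * k x) ≤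
      ∫⁻ t, ENNReal.ofReal (k₁ t) * ENNReal.ofReal (p t) := by
    rw [hlay (fun t => -p t) hp.measurable.neg, hlay _ hp.measurable]
    have : ENNReal.ofReal (m * k x) =
        ∫⁻ s in Ioi 0, (Iio (k x)).indicator (fun _ => ENNReal.ofReal m) s := by
      rw [lintegral_indicator measurableSet_Iio, setLIntegral_const,
        Measure.restrict_apply measurableSet_Iio, Iio_inter_Ioi, Real.volume_Ioo, sub_zero,
        ENNReal.ofReal_mul hm]
    rw [this, ← lintegral_add_right _ (measurable_const.indicator measurableSet_Iio)]
    exact setLIntegral_mono' measurableSet_Ioi fun s hs => hlevel s hs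
  have hki₁ : Integrable k₁ := by
    rw [hk₁, integrable_indicator_iff measurableSet_Ioo]
    exact ((intervalIntegrable_iff_integrableOn_Ioc_of_le hab).1 hki).mono_set Ioo_subset_Ioc_self
  have hkp : Integrable fun t => k₁ t * p t := by
    obtain ⟨C, hC⟩ := (isCompact_Icc (a := a) (b := b)).exists_bound_of_continuousOn
      hp.continuousOn
    refine (hki₁.mul_const C).mono (hmeas.mul hp.measurable).aestronglyMeasurable
      (ae_of_all _ fun t => ?_)
    by_cases ht : t ∈ Ioo a b
    · rw [norm_mul, norm_mul]
      exact mul_le_mul_of_nonneg_left ((hC t (Ioo_subset_Icc_self ht)).trans (le_abs_self C))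
        (norm_nonneg _)
    · simp [hk₁, ht]
  have hI : ∫ t in a..b, k t * p t = ∫ t, k₁ t * p t := by
    rw [intervalIntegral.integral_of_le hab, integral_Ioc_eq_integral_Ioo,
      ← integral_indicator measurableSet_Ioo]
    refine integral_congr_ae (ae_of_all _ fun t => ?_)
    by_cases ht : t ∈ Ioo a b <;> simp [hk₁, ht]
  rw [hI, integral_eq_lintegral_pos_part_sub_lintegral_neg_part hkp]
  have e1 : ∀ t, ENNReal.ofReal (k₁ t * p t) = ENNReal.ofReal (k₁ t) * ENNReal.ofReal (p t) :=
    fun t => ENNReal.ofReal_mul (hk₁0 t)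
  have e2 : ∀ t, ENNReal.ofReal (-(k₁ t * p t)) =
      ENNReal.ofReal (k₁ t) * ENNReal.ofReal (-p t) :=
    fun t => by rw [← mul_neg, ENNReal.ofReal_mul (hk₁0 t)]
  have f1 := hkp.lintegral_lt_top.ne
  have f2 := hkp.neg.lintegral_lt_top.ne
  simp only [Pi.neg_apply, e1, e2] at f1 f2 ⊢
  have := ENNReal.toReal_mono f1 hsum
  rw [ENNReal.toReal_add f2 (by simp), ENNReal.toReal_ofReal (mul_nonneg hm (hk0 x hx))] at this
  linarith

/-! ### Tangential and normal components of chords -/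

/-- A plane curve `Z` on `[0, S]`, parametrized by arc length, with tangent angle `τ` and
increasing curvature `k`. For convenience the data are defined on the whole line, where `k` is
locally integrable. -/
structure IsRisingArc (S : ℝ) (k τ : ℝ → ℝ) (Z : ℝ → ℂ) : Prop where
  pos : 0 < S
  mono : MonotoneOn k (Ioo 0 S)
  integrable : ∀ a b, IntervalIntegrable k volume a b
  continuous_angle : Continuous τ
  deriv_angle : ∃ F : Set ℝ, F.Countable ∧ ∀ x ∉ F, HasDerivAt τ (k x) x
  deriv_point : ∀ x, HasDerivAt Z (Complex.exp (τ x * Complex.I)) x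

/-- `w` is a continuous choice of the direction of the chords from `Z u` to the end point `Z S`,
equal to the tangent angle at the end point. -/
structure IsEndChordAngle (S : ℝ) (τ : ℝ → ℝ) (Z : ℝ → ℂ) (w : ℝ → ℝ) : Prop where
  continuousOn : ContinuousOn w (Icc 0 S)
  last : w S = τ S
  chord : ∀ u ∈ Ico 0 S, Z S - Z u = (‖Z S - Z u‖ : ℂ) * Complex.exp (w u * Complex.I)

namespace IsRisingArc

variable {S : ℝ} {k τ : ℝ → ℝ} {Z : ℝ → ℂ}

/-- The component of the chord from `Z x` to `Z b` along the tangent at `x`. -/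
noncomputable def tangential (τ : ℝ → ℝ) (Z : ℝ → ℂ) (b x : ℝ) : ℝ :=
  Real.cos (τ x) * (Z b - Z x).re + Real.sin (τ x) * (Z b - Z x).im

/-- The component of the chord from `Z x` to `Z b` along the left normal at `x`. -/
noncomputable def normal (τ : ℝ → ℝ) (Z : ℝ → ℂ) (b x : ℝ) : ℝ :=
  Real.cos (τ x) * (Z b - Z x).im - Real.sin (τ x) * (Z b - Z x).re

theorem continuous_point (h : IsRisingArc S k τ Z) : Continuous Z :=
  continuous_iff_continuousAt.2 fun x => (h.deriv_point x).continuousAt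

theorem hasDerivAt_re (h : IsRisingArc S k τ Z) (x : ℝ) :
    HasDerivAt (fun x => (Z x).re) (Real.cos (τ x)) x := by
  have := Complex.reCLM.hasFDerivAt.comp_hasDerivAt x (h.deriv_point x)
  simpa [Function.comp_def, Complex.exp_ofReal_mul_I_re] using this

theorem hasDerivAt_im (h : IsRisingArc S k τ Z) (x : ℝ) :
    HasDerivAt (fun x => (Z x).im) (Real.sin (τ x)) x := by
  have := Complex.imCLM.hasFDerivAt.comp_hasDerivAt x (h.deriv_point x)
  simpa [Function.comp_def, Complex.exp_ofReal_mul_I_im] using this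

theorem continuous_tangential (h : IsRisingArc S k τ Z) (b : ℝ) :
    Continuous (tangential τ Z b) := by
  have h1 := h.continuous_angle
  have h2 := h.continuous_point
  unfold tangential
  fun_prop

/-- The integrand is the derivative of `-‖Z b - Z x‖ ^ 2 / 2`. Hence its tail integrals are
nonnegative even where it changes sign, as the rearrangement inequality requires. -/
theorem integral_tangential (h : IsRisingArc S k τ Z) (b y : ℝ) :
    ∫ x in y..b, tangential τ Z b x = ‖Z b - Z y‖ ^ 2 / 2 := by
  have hd : ∀ x, HasDerivAt (fun x => -(((Z b).re - (Z x).re) ^ 2 + ((Z b).im - (Z x).im) ^ 2) / 2)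
      (tangential τ Z b x) x := by
    intro x
    have h1 := ((h.hasDerivAt_re x).const_sub (Z b).re).pow 2
    have h2 := ((h.hasDerivAt_im x).const_sub (Z b).im).pow 2
    refine ((h1.add h2).neg.div_const 2).congr_deriv ?_
    simp [tangential]
    ring
  rw [intervalIntegral.integral_eq_sub_of_hasDerivAt (fun x _ => hd x)
    ((h.continuous_tangential b).intervalIntegrable _ _), ← Complex.normSq_eq_norm_sq,
    Complex.normSq_apply]
  simp
  ring

theorem intervalIntegrable_mul_tangential (h : IsRisingArc S k τ Z) (a b c : ℝ) :
    IntervalIntegrable (fun x => k x * tangential τ Z c x) volume a b :=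
  (h.integrable a b).mul_continuousOn (h.continuous_tangential c).continuousOn

theorem integral_mul_tangential (h : IsRisingArc S k τ Z) {a b : ℝ} (hab : a ≤ b) :
    ∫ x in a..b, k x * tangential τ Z b x = normal τ Z b a := by
  obtain ⟨F, hF, hτ⟩ := h.deriv_angle
  have h1 := h.continuous_angle
  have h2 := h.continuous_point
  have hd : ∀ x ∈ Ioo a b \ F,
      HasDerivAt (fun x => -normal τ Z b x) (k x * tangential τ Z b x) x := by
    intro x hx
    have hc := (hτ x hx.2).cos.mul ((h.hasDerivAt_im x).const_sub (Z b).im)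
    have hs := (hτ x hx.2).sin.mul ((h.hasDerivAt_re x).const_sub (Z b).re)
    refine ((hc.sub hs).neg).congr_deriv ?_
    simp [tangential]
    ring
  rw [integral_eq_of_hasDerivAt_off_countable_of_le _ _ hab hF ?_ hd
    (h.intervalIntegrable_mul_tangential a b b)]
  · simp [normal]
  · unfold normal
    fun_prop

theorem integral_sub_mul_tangential (h : IsRisingArc S k τ Z) {a b : ℝ} (hab : a ≤ b) (c : ℝ) :
    ∫ x in a..b, (k x - c) * tangential τ Z b x =
      normal τ Z b a - c * (‖Z b - Z a‖ ^ 2 / 2) := by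
  simp_rw [sub_mul]
  rw [intervalIntegral.integral_sub (h.intervalIntegrable_mul_tangential a b b)
    (((h.continuous_tangential b).const_mul c).intervalIntegrable _ _),
    intervalIntegral.integral_const_mul, h.integral_mul_tangential hab, h.integral_tangential]

theorem exists_chord_lower_bound (h : IsRisingArc S k τ Z) {b u x : ℝ} (hux : u ≤ x)
    (hne : ∀ y ∈ Icc u x, Z y ≠ Z b) :
    ∃ m, 0 < m ∧ ∀ y ∈ Icc u x, m ≤ ∫ t in y..b, tangential τ Z b t := by
  obtain ⟨y₀, hy₀, hmin⟩ := (isCompact_Icc (a := u) (b := x)).exists_isMinOn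
    (nonempty_Icc.2 hux) (f := fun y => ‖Z b - Z y‖)
    (continuous_const.sub h.continuous_point).norm.continuousOn
  have h0 : 0 < ‖Z b - Z y₀‖ := norm_pos_iff.2 (sub_ne_zero.2 (hne y₀ hy₀).symm)
  refine ⟨‖Z b - Z y₀‖ ^ 2 / 2, by positivity, fun y hy => ?_⟩
  rw [h.integral_tangential]
  have : ‖Z b - Z y₀‖ ≤ ‖Z b - Z y‖ := hmin hy
  gcongr

theorem integral_tangential_nonneg (h : IsRisingArc S k τ Z) (b y : ℝ) :
    0 ≤ ∫ t in y..b, tangential τ Z b t := by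
  rw [h.integral_tangential]
  positivity

/-- A curve with curvature at least `c` stays to the left of the circle of curvature `c` that is
tangent to it at its starting point. -/
theorem le_normal (h : IsRisingArc S k τ Z) {u b c : ℝ} (hu : 0 ≤ u) (hub : u < b) (hb : b ≤ S)
    (hc : ∀ t ∈ Ioo u b, c ≤ k t) : c * (‖Z b - Z u‖ ^ 2 / 2) ≤ normal τ Z b u := by
  obtain ⟨x, hx⟩ := exists_between hub
  have := mul_le_integral_mul_of_monotoneOn (k := fun t => k t - c) (m := 0) hx
    (fun s hs t ht hst => sub_le_sub_right (h.mono ⟨hu.trans_lt hs.1, hs.2.trans_le hb⟩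
      ⟨hu.trans_lt ht.1, ht.2.trans_le hb⟩ hst) c) (fun t ht => sub_nonneg.2 (hc t ht))
    ((h.integrable u b).sub intervalIntegrable_const) (h.continuous_tangential b)
    (fun y _ => h.integral_tangential_nonneg b y) le_rfl
    (fun y _ => h.integral_tangential_nonneg b y)
  rw [h.integral_sub_mul_tangential hub.le] at this
  linarith

/-- Strictness comes from a positive `m` in the rearrangement inequality: by compactness the chord
to `Z b` stays away from zero on `[u, x]`. -/
theorem lt_normal (h : IsRisingArc S k τ Z) {u b c x : ℝ} (hu : 0 ≤ u) (hb : b ≤ S)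
    (hc : ∀ t ∈ Ioo u b, c ≤ k t) (hx : x ∈ Ioo u b) (hcx : c < k x)
    (hne : ∀ y ∈ Icc u x, Z y ≠ Z b) : c * (‖Z b - Z u‖ ^ 2 / 2) < normal τ Z b u := by
  obtain ⟨m, hm0, hm⟩ := h.exists_chord_lower_bound hx.1.le hne
  have := mul_le_integral_mul_of_monotoneOn (k := fun t => k t - c) hx
    (fun s hs t ht hst => sub_le_sub_right (h.mono ⟨hu.trans_lt hs.1, hs.2.trans_le hb⟩
      ⟨hu.trans_lt ht.1, ht.2.trans_le hb⟩ hst) c) (fun t ht => sub_nonneg.2 (hc t ht))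
    ((h.integrable u b).sub intervalIntegrable_const) (h.continuous_tangential b)
    (fun y _ => h.integral_tangential_nonneg b y) hm0.le hm
  rw [h.integral_sub_mul_tangential (hx.1.trans hx.2).le] at this
  have := mul_pos hm0 (sub_pos.2 hcx)
  linarith

theorem integral_curvature (h : IsRisingArc S k τ Z) {a b : ℝ} (hab : a ≤ b) :
    ∫ x in a..b, k x = τ b - τ a := by
  obtain ⟨F, hF, hτ⟩ := h.deriv_angle
  exact integral_eq_of_hasDerivAt_off_countable_of_le _ _ hab hF h.continuous_angle.continuousOn
    (fun x hx => hτ x hx.2) (h.integrable a b)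

/-- If a curve of increasing curvature returns to a point, its curvature is constant in between. -/
theorem curvature_eq_of_closed (h : IsRisingArc S k τ Z) {a b : ℝ} (ha : 0 ≤ a) (hab : a < b)
    (hb : b ≤ S) (hZ : Z a = Z b) (hne : ∀ y ∈ Ioo a b, Z y ≠ Z b) {x y : ℝ}
    (hx : x ∈ Ioo a b) (hy : y ∈ Ioo a b) (hxy : x ≤ y) : k x = k y := by
  have hmono : MonotoneOn k (Ioo a b) :=
    h.mono.mono fun t ht => ⟨ha.trans_lt ht.1, ht.2.trans_le hb⟩
  by_contra hk
  have hlt : k x < k y := lt_of_le_of_ne (hmono hx hy hxy) hk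
  have hxy' : x < y := lt_of_le_of_ne hxy fun e => hk (e ▸ rfl)
  have hII : ∀ s t, IntervalIntegrable (fun z => (k z - k x) * tangential τ Z b z) volume s t :=
    fun s t => ((h.integrable s t).sub intervalIntegrable_const).mul_continuousOn
      (h.continuous_tangential b).continuousOn
  -- The chord from `a` to `b` vanishes, so the total is zero; it is then shown to be a positive
  -- right part plus a nonnegative left part.
  have htot : ∫ z in a..b, (k z - k x) * tangential τ Z b z = 0 := by
    rw [h.integral_sub_mul_tangential hab.le, hZ]
    simp [normal, hZ]
  have hright : 0 < ∫ z in x..b, (k z - k x) * tangential τ Z b z := by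
    rw [h.integral_sub_mul_tangential hx.2.le, sub_pos]
    exact h.lt_normal (ha.trans hx.1.le) hb (fun t ht => hmono hx ⟨hx.1.trans ht.1, ht.2⟩ ht.1.le)
      ⟨hxy', hy.2⟩ hlt fun z hz => hne z ⟨hx.1.trans_le hz.1, hz.2.trans_lt hy.2⟩
  -- Reflecting `[a, x]` turns `k x - k` into an increasing nonnegative weight. The tails of the
  -- reflected `-tangential` are `-∫ tangential` over initial segments, which equal the integrals
  -- over the complementary tails because the integral over `[a, b]` is zero.
  have hleft : 0 ≤ ∫ z in a..x, (k z - k x) * tangential τ Z b z := by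
    obtain ⟨z₀, hz₀⟩ := exists_between hx.1
    have hmem : ∀ t ∈ Ioo a x, a + x - t ∈ Ioo a b := fun t ht =>
      ⟨by linarith [ht.2], by linarith [ht.1, hx.2]⟩
    have hcont : Continuous fun t => tangential τ Z b (a + x - t) :=
      (h.continuous_tangential b).comp (by fun_prop)
    have hQ : ∀ y ∈ Icc a x, 0 ≤ ∫ t in y..x, -tangential τ Z b (a + x - t) := by
      intro y hy
      rw [intervalIntegral.integral_neg, intervalIntegral.integral_comp_sub_left
        (fun t => tangential τ Z b t), add_sub_cancel_right]
      have h1 := intervalIntegral.integral_add_adjacent_intervals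
        ((h.continuous_tangential b).intervalIntegrable (μ := volume) a (a + x - y))
        ((h.continuous_tangential b).intervalIntegrable (a + x - y) b)
      have h2 := h.integral_tangential_nonneg b (a + x - y)
      have h3 : ∫ t in a..b, tangential τ Z b t = 0 := by rw [h.integral_tangential, hZ]; simp
      linarith
    have := mul_le_integral_mul_of_monotoneOn (k := fun t => k x - k (a + x - t))
      (p := fun t => -tangential τ Z b (a + x - t)) (m := 0) hz₀
      (fun s hs t ht hst => sub_le_sub_left (hmono (hmem t ht) (hmem s hs) (by linarith)) _)
      (fun t ht => sub_nonneg.2 (hmono (hmem t ht) hx (by linarith [ht.1])))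
      (intervalIntegrable_const.sub (by
        simpa using (h.integrable x a).comp_sub_left (a + x)))
      hcont.neg hQ le_rfl (fun y hy => hQ y ⟨hy.1, hy.2.trans hz₀.2.le⟩)
    have hsub := intervalIntegral.integral_comp_sub_left
      (fun z => (k z - k x) * tangential τ Z b z) (a + x) (a := a) (b := x)
    rw [add_sub_cancel_right, add_sub_cancel_left] at hsub
    rw [← hsub, ← zero_mul (k x - k (a + x - z₀))]
    exact this.trans_eq (intervalIntegral.integral_congr fun t _ => by ring)
  have := intervalIntegral.integral_add_adjacent_intervals (hII a x) (hII x b)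
  linarith

end IsRisingArc

/-! ### Differentiating a continuous argument -/

/-- The derivative of a continuous argument of a nonvanishing complex function. -/
theorem hasDerivAt_of_eq_norm_mul_exp {f : ℝ → ℂ} {w : ℝ → ℝ} {f' : ℂ} {x : ℝ}
    (hf : HasDerivAt f f' x) (h0 : f x ≠ 0) (hw : ContinuousAt w x)
    (hfw : ∀ᶠ y in nhds x, f y = (‖f y‖ : ℂ) * Complex.exp (w y * Complex.I)) :
    HasDerivAt w (f' / f x).im x := by
  have hdiv : HasDerivAt (fun y => f y / f x) (f' / f x) x := hf.div_const _
  have hlog : HasDerivAt (fun y => Complex.log (f y / f x)) (f' / f x) x := by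
    simpa [h0] using hdiv.clog_real (by simp [h0])
  have him : HasDerivAt (fun y => (Complex.log (f y / f x)).im) (f' / f x).im x := by
    simpa [Function.comp_def] using Complex.imCLM.hasFDerivAt.comp_hasDerivAt x hlog
  refine ((him.const_add (w x)).congr_of_eventuallyEq ?_)
  -- Within this range the principal argument of `f y / f x` is exactly `w y - w x`.
  have hnear : ∀ᶠ y in nhds x, w y - w x ∈ Ioo (-Real.pi) Real.pi := by
    have : ContinuousAt (fun y => w y - w x) x := hw.sub continuousAt_const
    exact this.eventually_mem (by
      simpa using Ioo_mem_nhds (neg_lt_zero.2 Real.pi_pos) Real.pi_pos)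
  have hx := hfw.self_of_nhds
  filter_upwards [hfw, hnear, hf.continuousAt.eventually_ne h0] with y hy hyw hy0
  have hpos : 0 < ‖f y‖ / ‖f x‖ := div_pos (norm_pos_iff.2 hy0) (norm_pos_iff.2 h0)
  have : f y / f x = ((‖f y‖ / ‖f x‖ : ℝ) : ℂ) * Complex.exp ((w y - w x : ℝ) * Complex.I) := by
    rw [hy, hx]
    push_cast
    rw [sub_mul, Complex.exp_sub]
    have h1 : (‖f x‖ : ℂ) ≠ 0 := by simpa using h0
    simp
    field_simp
  rw [Complex.log_im, this, Complex.arg_real_mul _ hpos, Complex.arg_exp_mul_I,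
    (toIocMod_eq_self _).2 ⟨hyw.1, by linarith [hyw.2]⟩]
  ring

/-! ### Loops and boundary angles for increasing curvature -/

namespace IsRisingArc

variable {S : ℝ} {k τ : ℝ → ℝ} {Z : ℝ → ℂ} {w : ℝ → ℝ}

/-- The velocity is nonzero, so `Z v` is not attained just before `v`; hence a last earlier visit
`a` to this point exists, and between `a` and `v` there is no other. -/
theorem exists_closed_subarc (h : IsRisingArc S k τ Z) (hZ : ¬ InjOn Z (Icc 0 S)) :
    ∃ a b c, 0 ≤ a ∧ a < b ∧ b ≤ S ∧ Z a = Z b ∧ ∀ x ∈ Ioo a b, k x = c := by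
  obtain ⟨u, hu, v, hv, huv, hlt⟩ : ∃ u ∈ Icc 0 S, ∃ v ∈ Icc 0 S, Z u = Z v ∧ u < v := by
    simp only [InjOn, not_forall] at hZ
    obtain ⟨u, hu, v, hv, huv, hne⟩ := hZ
    rcases lt_or_gt_of_ne hne with hl | hl
    exacts [⟨u, hu, v, hv, huv, hl⟩, ⟨v, hv, u, hu, huv.symm, hl⟩]
  have hev : ∀ᶠ x in nhdsWithin v (Iio v), Z x ≠ Z v :=
    ((h.deriv_point v).eventually_ne (Complex.exp_ne_zero _)).filter_mono
      (nhdsWithin_mono v fun x hx => ne_of_lt hx)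
  obtain ⟨l, hl, hlv⟩ := (mem_nhdsLT_iff_exists_Ioo_subset).1 hev
  have hcomp : IsCompact (Icc u l ∩ {x | Z x = Z v}) :=
    isCompact_Icc.inter_right (isClosed_eq h.continuous_point continuous_const)
  have hul : u ≤ l := not_lt.1 fun hlu => hlv ⟨hlu, hlt⟩ huv
  obtain ⟨a, ha, hmax⟩ := hcomp.exists_isGreatest ⟨u, ⟨le_rfl, hul⟩, huv⟩
  have hav : a < v := ha.1.2.trans_lt hl
  have hne : ∀ y ∈ Ioo a v, Z y ≠ Z v := by
    intro y hy hyv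
    rcases le_or_gt y l with hyl | hyl
    · exact absurd (hmax ⟨⟨ha.1.1.trans hy.1.le, hyl⟩, hyv⟩) (not_le.2 hy.1)
    · exact hlv ⟨hyl, hy.2⟩ hyv
  have h0a : 0 ≤ a := hu.1.trans ha.1.1
  have hmid : (a + v) / 2 ∈ Ioo a v := ⟨by linarith, by linarith⟩
  refine ⟨a, v, k ((a + v) / 2), h0a, hav, hv.2, ha.2, fun x hx => ?_⟩
  rcases le_total x ((a + v) / 2) with hle | hle
  · exact h.curvature_eq_of_closed h0a hav hv.2 ha.2 hne hx hmid hle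
  · exact (h.curvature_eq_of_closed h0a hav hv.2 ha.2 hne hmid hx hle).symm

theorem ne_last (hinj : InjOn Z (Icc 0 S)) {y : ℝ} (hy : y ∈ Ico 0 S) : Z y ≠ Z S := fun e =>
  hy.2.ne (hinj ⟨hy.1, hy.2.le⟩ ⟨hy.1.trans hy.2.le, le_rfl⟩ e)

theorem norm_chord_pos (hinj : InjOn Z (Icc 0 S)) {y : ℝ} (hy : y ∈ Ico 0 S) :
    0 < ‖Z S - Z y‖ := norm_pos_iff.2 (sub_ne_zero.2 (ne_last hinj hy).symm)

theorem normal_eq (hw : IsEndChordAngle S τ Z w) {u : ℝ} (hu : u ∈ Ico 0 S) :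
    normal τ Z S u = -(‖Z S - Z u‖ * Real.sin (τ u - w u)) := by
  have hre : (Z S - Z u).re = ‖Z S - Z u‖ * Real.cos (w u) := by
    conv_lhs => rw [hw.chord u hu]
    rw [Complex.re_ofReal_mul, Complex.exp_ofReal_mul_I_re]
  have him : (Z S - Z u).im = ‖Z S - Z u‖ * Real.sin (w u) := by
    conv_lhs => rw [hw.chord u hu]
    rw [Complex.im_ofReal_mul, Complex.exp_ofReal_mul_I_im]
  rw [normal, hre, him, Real.sin_sub]
  ring

theorem hasDerivAt_chordAngle (h : IsRisingArc S k τ Z) (hinj : InjOn Z (Icc 0 S))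
    (hw : IsEndChordAngle S τ Z w) {u : ℝ} (hu : u ∈ Ioo 0 S) :
    HasDerivAt w (normal τ Z S u / ‖Z S - Z u‖ ^ 2) u := by
  have h0 := ne_last hinj ⟨hu.1.le, hu.2⟩
  refine (hasDerivAt_of_eq_norm_mul_exp ((h.deriv_point u).const_sub (Z S))
    (sub_ne_zero.2 h0.symm) (hw.continuousOn.continuousAt (Icc_mem_nhds hu.1 hu.2)) ?_).congr_deriv
    ?_
  · filter_upwards [Ioo_mem_nhds hu.1 hu.2] with y hy
    exact hw.chord y ⟨hy.1.le, hy.2⟩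
  · rw [Complex.div_im, Complex.normSq_eq_norm_sq, normal]
    simp only [Complex.neg_re, Complex.neg_im, Complex.exp_ofReal_mul_I_re,
      Complex.exp_ofReal_mul_I_im]
    ring

theorem continuous_normal (h : IsRisingArc S k τ Z) (b : ℝ) : Continuous (normal τ Z b) := by
  have h1 := h.continuous_angle
  have h2 := h.continuous_point
  unfold normal
  fun_prop

theorem intervalIntegrable_sub_mul_normal (h : IsRisingArc S k τ Z) (hinj : InjOn Z (Icc 0 S))
    {u v : ℝ} (hu : 0 ≤ u) (huv : u ≤ v) (hv : v < S) (c : ℝ) :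
    IntervalIntegrable (fun x => k x - c * (normal τ Z S x / ‖Z S - Z x‖ ^ 2)) volume u v := by
  refine (h.integrable u v).sub (ContinuousOn.intervalIntegrable ?_)
  rw [uIcc_of_le huv]
  refine continuousOn_const.mul (((h.continuous_normal S).continuousOn).div
    ((continuous_const.sub h.continuous_point).norm.pow 2).continuousOn fun x hx => ?_)
  exact (pow_pos (norm_chord_pos hinj ⟨hu.trans hx.1, hx.2.trans_lt hv⟩) 2).ne'

theorem integral_sub_mul_normal (h : IsRisingArc S k τ Z) (hinj : InjOn Z (Icc 0 S))
    (hw : IsEndChordAngle S τ Z w) {u v : ℝ} (hu : 0 ≤ u) (huv : u ≤ v) (hv : v < S) (c : ℝ) :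
    ∫ x in u..v, (k x - c * (normal τ Z S x / ‖Z S - Z x‖ ^ 2)) =
      (τ v - c * w v) - (τ u - c * w u) := by
  obtain ⟨F, hF, hτ⟩ := h.deriv_angle
  refine integral_eq_of_hasDerivAt_off_countable_of_le (fun x => τ x - c * w x) _ huv hF ?_
    (fun x hx => (hτ x hx.2).sub ((h.hasDerivAt_chordAngle hinj hw
      ⟨hu.trans_lt hx.1.1, hx.1.2.trans hv⟩).const_mul c))
    (h.intervalIntegrable_sub_mul_normal hinj hu huv hv c)
  exact h.continuous_angle.continuousOn.sub (continuousOn_const.mul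
    (hw.continuousOn.mono (Icc_subset_Icc hu hv.le)))

/-- **Vogt's theorem**: the sum of the boundary angles is positive. -/
theorem boundaryAngle_add_pos (h : IsRisingArc S k τ Z) (hinj : InjOn Z (Icc 0 S))
    (hw : IsEndChordAngle S τ Z w) {x y : ℝ} (hx : x ∈ Ioo 0 S) (hy : y ∈ Ioo 0 S) (hxy : x < y)
    (hk : k x < k y) : 0 < (τ 0 - w 0) + (τ S - w 0) := by
  -- The derivative `k - 2 * normal / ‖chord‖ ^ 2` of `τ - 2 * w` is nonpositive by comparison with
  -- the circle of curvature `k t`. The quotient degenerates at `S`, which is reached only by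
  -- continuity.
  have hle : ∀ v ∈ Ioo x S, τ v - 2 * w v ≤ τ x - 2 * w x := by
    intro v hv
    rw [← sub_nonpos, ← h.integral_sub_mul_normal hinj hw hx.1.le hv.1.le hv.2 2]
    rw [← neg_nonneg, ← intervalIntegral.integral_neg]
    refine intervalIntegral.integral_nonneg hv.1.le fun t ht => ?_
    have htS : t ∈ Ioo 0 S := ⟨hx.1.trans_le ht.1, ht.2.trans_lt hv.2⟩
    have := h.le_normal (c := k t) htS.1.le htS.2 le_rfl
      fun s hs => h.mono htS ⟨htS.1.trans hs.1, hs.2⟩ hs.1.le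
    have hl := pow_pos (norm_chord_pos hinj ⟨htS.1.le, htS.2⟩) 2
    rw [neg_nonneg, sub_nonpos, mul_div_assoc', le_div_iff₀ hl]
    linarith
  have hend : τ S - 2 * w S ≤ τ x - 2 * w x := by
    have hcont : ContinuousWithinAt (fun v => τ v - 2 * w v) (Ioo x S) S :=
      (h.continuous_angle.continuousWithinAt).sub (continuousWithinAt_const.mul
        ((hw.continuousOn S ⟨h.pos.le, le_rfl⟩).mono fun v hv => ⟨(hx.1.trans hv.1).le, hv.2.le⟩))
    have : (nhdsWithin S (Ioo x S)).NeBot := right_nhdsWithin_Ioo_neBot hx.2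
    exact le_of_tendsto hcont (eventually_nhdsWithin_of_forall hle)
  -- On `(0, x)` the decrease is strict, since the later value `k y` exceeds `k t`.
  have hlt : τ x - 2 * w x < τ 0 - 2 * w 0 := by
    rw [← sub_neg, ← h.integral_sub_mul_normal hinj hw le_rfl hx.1.le hx.2 2, ← neg_pos,
      ← intervalIntegral.integral_neg]
    refine intervalIntegral.intervalIntegral_pos_of_pos_on
      (h.intervalIntegrable_sub_mul_normal hinj le_rfl hx.1.le hx.2 2).neg (fun t ht => ?_) hx.1
    have htS : t ∈ Ioo 0 S := ⟨ht.1, ht.2.trans hx.2⟩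
    have := h.lt_normal (c := k t) ht.1.le le_rfl
      (fun s hs => h.mono htS ⟨ht.1.trans hs.1, hs.2⟩ hs.1.le) ⟨ht.2.trans hxy, hy.2⟩
      ((h.mono htS hx ht.2.le).trans_lt hk)
      fun z hz => ne_last hinj ⟨ht.1.le.trans hz.1, hz.2.trans_lt hy.2⟩
    have hl := pow_pos (norm_chord_pos hinj ⟨ht.1.le, htS.2⟩) 2
    rw [neg_pos, sub_neg, mul_div_assoc', lt_div_iff₀ hl]
    linarith
  rw [hw.last] at hend
  linarith

theorem neg_pi_lt_boundaryAngle (h : IsRisingArc S k τ Z) (hinj : InjOn Z (Icc 0 S))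
    (hw : IsEndChordAngle S τ Z w) : -Real.pi < τ 0 - w 0 := by
  by_contra hcon
  have hcont : ContinuousOn (fun u => τ u - w u) (Icc 0 S) :=
    h.continuous_angle.continuousOn.sub hw.continuousOn
  have hcomp : IsCompact (Icc 0 S ∩ (fun u => τ u - w u) ⁻¹' Iic (-Real.pi)) :=
    isCompact_Icc.of_isClosed_subset (hcont.preimage_isClosed_of_isClosed isClosed_Icc isClosed_Iic)
      inter_subset_left
  obtain ⟨u, ⟨hu, hule⟩, hmax⟩ := hcomp.exists_isGreatest
    ⟨0, ⟨le_rfl, h.pos.le⟩, not_lt.1 hcon⟩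
  simp only [mem_preimage, mem_Iic] at hule
  have huS : u < S := by
    refine lt_of_le_of_ne hu.2 fun e => ?_
    rw [e, hw.last, sub_self] at hule
    linarith [Real.pi_pos]
  have hgt : ∀ v ∈ Ioc u S, -Real.pi < τ v - w v := by
    intro v hv
    by_contra hv'
    exact absurd (hmax ⟨⟨hu.1.trans hv.1.le, hv.2⟩, not_lt.1 hv'⟩) (not_le.2 hv.1)
  have hright : ContinuousWithinAt (fun v => τ v - w v) (Ioi u) u :=
    (hcont u hu).mono_of_mem_nhdsWithin (Filter.mem_of_superset (Ioo_mem_nhdsGT huS)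
      fun v hv => ⟨hu.1.trans hv.1.le, hv.2.le⟩)
  have heq : τ u - w u = -Real.pi := by
    refine le_antisymm hule (ge_of_tendsto hright ?_)
    filter_upwards [Ioo_mem_nhdsGT huS] with v hv
    exact (hgt v ⟨hv.1, hv.2.le⟩).le
  have hneg : ∀ᶠ v in nhdsWithin u (Ioi u), τ v - w v < 0 :=
    hright.eventually (Iio_mem_nhds (heq.trans_lt (neg_lt_zero.2 Real.pi_pos)))
  obtain ⟨d, hd, hdneg⟩ := (mem_nhdsGT_iff_exists_Ioo_subset).1
    (Filter.inter_mem hneg (Ioo_mem_nhdsGT huS))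
  -- At the last time `u` where `τ - w ≤ -π` equality holds, so `normal` vanishes at `u`. If `k v ≤
  -- 0` soon after, then `k ≤ 0 ≤ normal` on `(u, v)` and `τ - w` cannot rise above `-π`. Otherwise
  -- `k` is positive after `u`, which forces `normal` to be positive at `u`.
  by_cases hk : ∃ v ∈ Ioo u d, k v ≤ 0
  · obtain ⟨v, hv, hkv⟩ := hk
    have hvS : v ∈ Ioo u S := (hdneg hv).2
    have hle : (τ v - 1 * w v) - (τ u - 1 * w u) ≤ 0 := by
      rw [← h.integral_sub_mul_normal hinj hw hu.1 hv.1.le hvS.2 1,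
        ← intervalIntegral.integral_zero (μ := volume) (a := u) (b := v)]
      refine intervalIntegral.integral_mono_on_of_le_Ioo hv.1.le
        (h.intervalIntegrable_sub_mul_normal hinj hu.1 hv.1.le hvS.2 1) intervalIntegrable_const
        fun t ht => ?_
      have htS : t ∈ Ioo u S := ⟨ht.1, ht.2.trans hvS.2⟩
      have ht0 : 0 < t := hu.1.trans_lt ht.1
      have hkt : k t ≤ 0 := (h.mono ⟨ht0, htS.2⟩ ⟨ht0.trans ht.2, hvS.2⟩ ht.2.le).trans hkv
      have hsin : Real.sin (τ t - w t) ≤ 0 := Real.sin_nonpos_of_nonpos_of_neg_pi_le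
        (hdneg ⟨ht.1, ht.2.trans hv.2⟩).1.le (hgt t ⟨ht.1, htS.2.le⟩).le
      have hN : 0 ≤ normal τ Z S t := by
        rw [normal_eq hw ⟨ht0.le, htS.2⟩, neg_nonneg]
        exact mul_nonpos_of_nonneg_of_nonpos (norm_nonneg _) hsin
      have : 0 ≤ normal τ Z S t / ‖Z S - Z t‖ ^ 2 := by positivity
      linarith
    linarith [hgt v ⟨hv.1, hvS.2.le⟩]
  · push Not at hk
    obtain ⟨x, hx⟩ := exists_between (show u < d from hd)
    have hxS : x ∈ Ioo u S := (hdneg hx).2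
    have := h.lt_normal (c := 0) hu.1 le_rfl (fun t ht => ?_) hxS (hk x hx)
      fun z hz => ne_last hinj ⟨hu.1.trans hz.1, hz.2.trans_lt hxS.2⟩
    · rw [normal_eq hw ⟨hu.1, huS⟩, heq] at this
      simp at this
    · rcases lt_or_ge t d with htd | htd
      · exact (hk t ⟨ht.1, htd⟩).le
      · exact (hk x hx).le.trans (h.mono ⟨hu.1.trans_lt hxS.1, hxS.2⟩
          ⟨hu.1.trans_lt ht.1, ht.2⟩ (hx.2.le.trans htd))

/-- Nonnegative curvature keeps the end point strictly to the left of each tangent, so `sin (τ - w)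
< 0` before `S`. As `τ - w` ends at `0`, a positive initial value would force it through `(0, π)`,
where the sine is positive. -/
theorem boundaryAngle_neg (h : IsRisingArc S k τ Z) (hinj : InjOn Z (Icc 0 S))
    (hw : IsEndChordAngle S τ Z w) (hk : ∀ t ∈ Ioo 0 S, 0 ≤ k t) {x : ℝ} (hx : x ∈ Ioo 0 S)
    (hkx : 0 < k x) : τ 0 - w 0 < 0 := by
  have hsin : ∀ u ∈ Ico 0 S, Real.sin (τ u - w u) < 0 := by
    intro u hu
    obtain ⟨y, hy⟩ := exists_between (max_lt hu.2 hx.2)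
    have huy : u < y := (le_max_left _ _).trans_lt hy.1
    have := h.lt_normal (c := 0) hu.1 le_rfl (fun t ht => hk t ⟨hu.1.trans_lt ht.1, ht.2⟩)
      ⟨huy, hy.2⟩ (hkx.trans_le (h.mono hx ⟨hu.1.trans_lt huy, hy.2⟩
        ((le_max_right _ _).trans hy.1.le)))
      fun z hz => ne_last hinj ⟨hu.1.trans hz.1, hz.2.trans_lt hy.2⟩
    rw [normal_eq hw hu, zero_mul, neg_pos] at this
    exact (pos_iff_neg_of_mul_neg this).1 (norm_chord_pos hinj hu)
  by_contra hcon
  have hcont : ContinuousOn (fun u => τ u - w u) (Icc 0 S) :=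
    h.continuous_angle.continuousOn.sub hw.continuousOn
  have hpos : 0 < τ 0 - w 0 := lt_of_le_of_ne (not_lt.1 hcon) fun e => by
    have := hsin 0 ⟨le_rfl, h.pos⟩
    simp [← e] at this
  have hmin : 0 < min (τ 0 - w 0) 1 := lt_min hpos one_pos
  obtain ⟨u, hu, hue⟩ := intermediate_value_Icc' h.pos.le hcont
    (show min (τ 0 - w 0) 1 ∈ Icc (τ S - w S) (τ 0 - w 0) from
      ⟨by rw [hw.last, sub_self]; exact hmin.le, min_le_left _ _⟩)
  simp only at hue
  have huS : u < S := by
    refine lt_of_le_of_ne hu.2 fun e => ?_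
    rw [e, hw.last, sub_self] at hue
    exact hmin.ne hue
  have h1 := hsin u ⟨hu.1, huS⟩
  rw [hue] at h1
  exact absurd (Real.sin_pos_of_pos_of_lt_pi hmin
    ((min_le_right _ _).trans_lt (by linarith [Real.pi_gt_three]))) (not_lt.2 h1.le)

/-- The arc run through backwards is again of increasing curvature. -/
theorem reverse (h : IsRisingArc S k τ Z) : IsRisingArc S (fun s => -k (S - s))
    (fun s => τ (S - s) + Real.pi) (fun s => Z (S - s)) where
  pos := h.pos
  mono := fun s hs t ht hst => neg_le_neg (h.mono ⟨by linarith [ht.2], by linarith [ht.1]⟩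
    ⟨by linarith [hs.2], by linarith [hs.1]⟩ (by linarith))
  integrable := fun a b => by
    have := (h.integrable (S - a) (S - b)).comp_sub_left S
    rw [sub_sub_cancel, sub_sub_cancel] at this
    exact this.neg
  continuous_angle := by
    have := h.continuous_angle
    fun_prop
  deriv_angle := by
    obtain ⟨F, hF, hτ⟩ := h.deriv_angle
    refine ⟨(fun s => S - s) ⁻¹' F, hF.preimage sub_right_injective, fun x hx => ?_⟩
    simpa using ((hτ (S - x) hx).comp_const_sub S x).add_const Real.pi
  deriv_point := fun x => by
    refine ((h.deriv_point (S - x)).comp_const_sub S x).congr_deriv ?_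
    push_cast
    rw [add_mul, Complex.exp_add, Complex.exp_pi_mul_I]
    ring

/-- The bounds for the cumulative boundary angles of an arc of increasing curvature. -/
theorem boundaryAngle_bounds (h : IsRisingArc S k τ Z) (hinj : InjOn Z (Icc 0 S))
    {m : ℝ × ℝ → ℝ} (hm : ContinuousOn m {p | 0 ≤ p.1 ∧ p.1 ≤ p.2 ∧ p.2 ≤ S})
    (hdiag : ∀ u ∈ Icc 0 S, m (u, u) = τ u)
    (hchord : ∀ u v : ℝ, 0 ≤ u → u < v → v ≤ S →
      Z v - Z u = (‖Z v - Z u‖ : ℂ) * Complex.exp ((m (u, v) : ℂ) * Complex.I))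
    {x y : ℝ} (hx : x ∈ Ioo 0 S) (hy : y ∈ Ioo 0 S) (hxy : x < y) (hk : k x < k y) :
    0 < (τ 0 - m (0, S)) + (τ S - m (0, S)) ∧ -Real.pi < τ 0 - m (0, S) ∧
      -Real.pi < τ S - m (0, S) ∧ ((∀ t ∈ Ioo 0 S, 0 ≤ k t) → τ 0 - m (0, S) < 0) ∧
      ((∀ t ∈ Ioo 0 S, k t ≤ 0) → τ S - m (0, S) < 0) := by
  have hS := h.pos
  have hw : IsEndChordAngle S τ Z fun u => m (u, S) :=
    { continuousOn := hm.comp (by fun_prop) fun u hu => ⟨hu.1, hu.2, le_rfl⟩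
      last := hdiag S ⟨hS.le, le_rfl⟩
      chord := fun u hu => hchord u S hu.1 hu.2 le_rfl }
  -- Reversal turns tangents and chords alike by `π`, so the initial boundary angle of the reversed
  -- arc is `τ S - m (0, S)`.
  have hw' : IsEndChordAngle S (fun s => τ (S - s) + Real.pi) (fun s => Z (S - s))
      fun u => m (0, S - u) + Real.pi :=
    { continuousOn := (hm.comp (by fun_prop) fun u hu =>
        ⟨le_rfl, sub_nonneg.2 hu.2, by linarith [hu.1]⟩).add continuousOn_const
      last := by simp [hdiag 0 ⟨le_rfl, hS.le⟩]
      chord := fun u hu => by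
        have := hchord 0 (S - u) le_rfl (sub_pos.2 hu.2) (by linarith [hu.1])
        rw [sub_self, norm_sub_rev, ← neg_sub, this]
        push_cast
        rw [add_mul, Complex.exp_add, Complex.exp_pi_mul_I]
        simp }
  have hinj' : InjOn (fun s => Z (S - s)) (Icc 0 S) := fun s hs t ht hst => by
    have := hinj ⟨sub_nonneg.2 hs.2, by linarith [hs.1]⟩ ⟨sub_nonneg.2 ht.2, by linarith [ht.1]⟩ hst
    linarith
  have h1 := h.boundaryAngle_add_pos hinj hw hx hy hxy hk
  have h2 := h.neg_pi_lt_boundaryAngle hinj hw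
  have h3 := h.reverse.neg_pi_lt_boundaryAngle hinj' hw'
  simp only [sub_zero, add_sub_add_right_eq_sub] at h3
  refine ⟨h1, h2, h3, fun hk0 => ?_, fun hk0 => ?_⟩
  · exact h.boundaryAngle_neg hinj hw hk0 hy ((hk0 x hx).trans_lt hk)
  · have := h.reverse.boundaryAngle_neg hinj' hw'
      (fun t ht => neg_nonneg.2 (hk0 _ ⟨by linarith [ht.2], by linarith [ht.1]⟩))
      (x := S - x) ⟨by linarith [hx.2], by linarith [hx.1]⟩
      (by simpa using hk.trans_le (hk0 y hy))
    simpa using this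

end IsRisingArc

/-! ### Closed arcs of constant curvature -/

/-- A closed arc of constant curvature contains a circle. -/
theorem exists_sphere_subset_image {a b c : ℝ} {τ : ℝ → ℝ} {Z : ℝ → ℂ} (hab : a < b)
    (hτ : ∀ x ∈ Icc a b, τ x = τ a + c * (x - a)) (hτc : Continuous τ)
    (hZ : ∀ x, HasDerivAt Z (Complex.exp (τ x * Complex.I)) x) (hclosed : Z a = Z b) :
    ∃ z r, 0 < r ∧ Metric.sphere z r ⊆ Z '' Icc a b := by
  have hint : ∀ x, Z x - Z a = ∫ t in a..x, Complex.exp (τ t * Complex.I) := fun x =>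
    (intervalIntegral.integral_eq_sub_of_hasDerivAt (fun t _ => hZ t)
      ((by fun_prop : Continuous fun t => Complex.exp (τ t * Complex.I)).intervalIntegrable
        _ _)).symm
  have hexp : ∀ x ∈ Icc a b, ∀ t ∈ uIcc a x, Complex.exp (τ t * Complex.I) =
      Complex.exp (τ a * Complex.I) * Complex.exp ((c * Complex.I) * ((t - a : ℝ) : ℂ)) := by
    intro x hx t ht
    rw [uIcc_of_le hx.1] at ht
    rw [hτ t ⟨ht.1, ht.2.trans hx.2⟩, ← Complex.exp_add]
    congr 1
    push_cast
    ring
  -- At `x = b` this makes the turning a multiple of `2π`; for general `x` it identifies the centre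
  -- of the circle.
  have hcI : ∀ x ∈ Icc a b, c * Complex.I * (Z x - Z a) =
      Complex.exp (τ x * Complex.I) - Complex.exp (τ a * Complex.I) := by
    intro x hx
    have hd : ∀ t ∈ uIcc a x, HasDerivAt (fun t : ℝ => Complex.exp (τ a * Complex.I) *
        Complex.exp ((c * Complex.I) * ((t - a : ℝ) : ℂ)))
        (c * Complex.I * Complex.exp (τ t * Complex.I)) t := by
      intro t ht
      rw [hexp x hx t ht]
      have h1 : HasDerivAt (fun t : ℝ => ((t - a : ℝ) : ℂ)) 1 t := by
        simpa using ((hasDerivAt_id t).sub_const a).ofReal_comp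
      refine (((h1.const_mul (c * Complex.I)).cexp).const_mul _).congr_deriv ?_
      ring
    rw [hint, ← intervalIntegral.integral_const_mul,
      intervalIntegral.integral_eq_sub_of_hasDerivAt hd (Continuous.intervalIntegrable
        (by fun_prop) _ _), ← hexp x hx x right_mem_uIcc, ← hexp x hx a left_mem_uIcc]
  have hb := hcI b ⟨hab.le, le_rfl⟩
  rw [hclosed, sub_self, mul_zero, eq_comm, sub_eq_zero, Complex.exp_eq_exp_iff_exists_int] at hb
  have hc : c ≠ 0 := by
    rintro rfl
    have h1 := hint b
    rw [intervalIntegral.integral_congr (hexp b ⟨hab.le, le_rfl⟩), hclosed] at h1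
    simp [sub_eq_zero, hab.ne'] at h1
  obtain ⟨n, hn⟩ := hb
  have hn' : c * (b - a) = n * (2 * Real.pi) := by
    have h2 : ((τ b : ℂ) - τ a - n * (2 * Real.pi)) * Complex.I = 0 := by
      linear_combination hn
    rw [mul_eq_zero, or_iff_left Complex.I_ne_zero, hτ b ⟨hab.le, le_rfl⟩] at h2
    have h3 : τ a + c * (b - a) - τ a - n * (2 * Real.pi) = 0 := by exact_mod_cast h2
    linarith
  have hlen : 2 * Real.pi ≤ |c| * (b - a) := by
    have hn0 : n ≠ 0 := by
      rintro rfl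
      have := mul_ne_zero hc (sub_pos.2 hab).ne'
      simp [hn'] at this
    have h1 : (1 : ℝ) ≤ |(n : ℝ)| := by exact_mod_cast Int.one_le_abs hn0
    have h2 : |c| * (b - a) = |(n : ℝ)| * (2 * Real.pi) := by
      rw [← abs_of_pos (sub_pos.2 hab), ← abs_mul, hn', abs_mul, abs_of_pos Real.two_pi_pos]
    rw [h2]
    nlinarith [Real.two_pi_pos]
  have hcI0 : (c : ℂ) * Complex.I ≠ 0 := mul_ne_zero (by exact_mod_cast hc) Complex.I_ne_zero
  refine ⟨Z a - Complex.exp (τ a * Complex.I) / (c * Complex.I), |c|⁻¹,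
    inv_pos.2 (abs_pos.2 hc), fun z hz => ?_⟩
  set q := (c * Complex.I) * (z - (Z a - Complex.exp (τ a * Complex.I) / (c * Complex.I))) with hq
  have hqn : ‖q‖ = 1 := by
    rw [mem_sphere_iff_norm] at hz
    rw [hq, norm_mul, hz]
    simp [abs_ne_zero.2 hc]
  obtain ⟨x, hx, hxq⟩ : ∃ x ∈ Icc a b, Complex.exp (τ x * Complex.I) = q := by
    have hp : 0 < 2 * Real.pi / |c| := div_pos Real.two_pi_pos (abs_pos.2 hc)
    -- The parameter at which the tangent angle would be `q.arg`, moved by full turns into the first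
    -- period; `hlen` ensures that this period fits into `[a, b]`.
    set y := toIcoMod hp a (a + (q.arg - τ a) / c) with hy
    have hym := toIcoMod_mem_Ico hp a (a + (q.arg - τ a) / c)
    have hyb : y ∈ Icc a b := by
      refine ⟨hym.1, hym.2.le.trans ?_⟩
      rw [← le_sub_iff_add_le', div_le_iff₀ (abs_pos.2 hc)]
      linarith
    refine ⟨y, hyb, ?_⟩
    obtain ⟨j, hj⟩ : ∃ j : ℤ, y = a + (q.arg - τ a) / c - j * (2 * Real.pi / |c|) :=
      ⟨toIcoDiv hp a (a + (q.arg - τ a) / c), by rw [hy, toIcoMod, zsmul_eq_mul]⟩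
    obtain ⟨i, hi⟩ : ∃ i : ℤ, τ y = q.arg + i * (2 * Real.pi) := by
      rcases lt_or_gt_of_ne hc with hneg | hpos
      · refine ⟨j, ?_⟩
        rw [hτ y hyb, hj, abs_of_neg hneg]
        field_simp
        ring
      · refine ⟨-j, ?_⟩
        rw [hτ y hyb, hj, abs_of_pos hpos]
        push_cast
        field_simp
        ring
    conv_rhs => rw [← Complex.norm_mul_exp_arg_mul_I q, hqn, Complex.ofReal_one, one_mul]
    rw [Complex.exp_eq_exp_iff_exists_int]
    refine ⟨i, ?_⟩
    rw [hi]
    push_cast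
    ring
  refine ⟨x, hx, ?_⟩
  have h1 := hcI x hx
  rw [hxq, hq] at h1
  have h2 : (c * Complex.I) * (Complex.exp (τ a * Complex.I) / (c * Complex.I)) =
      Complex.exp (τ a * Complex.I) := mul_div_cancel₀ _ hcI0
  apply mul_left_cancel₀ hcI0
  linear_combination h1 + h2

/-! ### Continuous choice of chord directions -/

/-- Two continuous arguments of the same function on a connected set agree if they agree at one
point. -/
theorem eqOn_of_exp_mul_I_eq {s : Set ℝ} (hs : IsPreconnected s) {f g : ℝ → ℝ}
    (hf : ContinuousOn f s) (hg : ContinuousOn g s)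
    (hfg : ∀ x ∈ s, Complex.exp (f x * Complex.I) = Complex.exp (g x * Complex.I))
    {x₀ : ℝ} (hx₀ : x₀ ∈ s) (h₀ : f x₀ = g x₀) : EqOn f g s :=
  Circle.isCoveringMap_exp.eqOn_of_comp_eqOn hs hf hg
    (fun x hx => Circle.ext (by simpa using hfg x hx)) hx₀ h₀

/-- An injective arc has a continuous choice of the directions of its chords. -/
theorem exists_continuous_chordAngle {S : ℝ} {τ : ℝ → ℝ} {Z : ℝ → ℂ} (hS : 0 ≤ S)
    (hτ : Continuous τ) (hZ : ∀ x, HasDerivAt Z (Complex.exp (τ x * Complex.I)) x)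
    (hinj : InjOn Z (Icc 0 S)) :
    ∃ m : ℝ × ℝ → ℝ, Continuous m ∧ (∀ u ∈ Icc 0 S, m (u, u) = τ u) ∧
      ∀ u v : ℝ, 0 ≤ u → u < v → v ≤ S →
        Z v - Z u = (‖Z v - Z u‖ : ℂ) * Complex.exp ((m (u, v) : ℂ) * Complex.I) := by
  -- The difference quotient `(Z v - Z u) / (v - u)`, extended continuously to the diagonal by the
  -- unit tangent; injectivity makes it nonzero on the square.
  let G : ℝ × ℝ → ℂ := fun p =>
    ∫ t in (0 : ℝ)..1, Complex.exp (τ (p.1 + t * (p.2 - p.1)) * Complex.I)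
  have hGc : Continuous G :=
    intervalIntegral.continuous_parametric_intervalIntegral_of_continuous' (by fun_prop) _ _
  have hGdiag : ∀ u, G (u, u) = Complex.exp (τ u * Complex.I) := fun u => by simp [G]
  have hGchord : ∀ u v, (v - u : ℝ) * G (u, v) = Z v - Z u := by
    intro u v
    have hd : ∀ t ∈ uIcc (0 : ℝ) 1, HasDerivAt (fun t => Z (u + t * (v - u)))
        (((v - u : ℝ) : ℂ) * Complex.exp (τ (u + t * (v - u)) * Complex.I)) t := by
      intro t _
      have := (hZ (u + t * (v - u))).scomp t
        (((hasDerivAt_id t).mul_const (v - u)).const_add u)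
      simpa [Function.comp_def] using this
    have := intervalIntegral.integral_eq_sub_of_hasDerivAt hd
      (Continuous.intervalIntegrable (by fun_prop) _ _)
    rw [intervalIntegral.integral_const_mul] at this
    simpa using this
  have hG0 : ∀ u ∈ Icc 0 S, ∀ v ∈ Icc 0 S, G (u, v) ≠ 0 := by
    intro u hu v hv h0
    rcases eq_or_ne u v with rfl | hne
    · exact Complex.exp_ne_zero _ (hGdiag u ▸ h0)
    · have := hGchord u v
      rw [h0, mul_zero, eq_comm, sub_eq_zero] at this
      exact hne (hinj hv hu this).symm
  -- Clamping to the square gives a nonvanishing function on the whole plane, which is simply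
  -- connected, so it lifts through `exp`.
  let P : ℝ × ℝ → ℝ × ℝ := fun p => ((projIcc 0 S hS p.1 : ℝ), (projIcc 0 S hS p.2 : ℝ))
  have hP : Continuous P := by
    have := continuous_projIcc (a := (0 : ℝ)) (b := S) (h := hS)
    fun_prop
  have hPeq : ∀ u ∈ Icc 0 S, ∀ v ∈ Icc 0 S, P (u, v) = (u, v) := fun u hu v hv => by
    simp [P, projIcc_of_mem hS hu, projIcc_of_mem hS hv]
  have h0S : (0 : ℝ) ∈ Icc 0 S := ⟨le_rfl, hS⟩
  obtain ⟨F, ⟨hF0, hF⟩, -⟩ := Complex.isCoveringMapOn_exp.existsUnique_continuousMap_lifts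
    ⟨fun p => G (P p), hGc.comp hP⟩ (a₀ := ((0 : ℝ), (0 : ℝ))) (e₀ := (τ 0 : ℂ) * Complex.I)
    (by simp [hPeq 0 h0S 0 h0S, hGdiag])
    (fun p => hG0 _ (projIcc 0 S hS p.1).2 _ (projIcc 0 S hS p.2).2)
  have hFexp : ∀ p, Complex.exp (F p) = G (P p) := fun p => congrFun hF p
  have hFG : ∀ p, G (P p) = (‖G (P p)‖ : ℂ) * Complex.exp ((F p).im * Complex.I) := by
    intro p
    rw [← hFexp, Complex.norm_exp, Complex.ofReal_exp, ← Complex.exp_add, Complex.re_add_im]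
  refine ⟨fun p => (F p).im, by fun_prop, ?_, ?_⟩
  · refine eqOn_of_exp_mul_I_eq isPreconnected_Icc (by fun_prop) hτ.continuousOn (fun u hu => ?_)
      h0S (by simp [hF0])
    have h1 := hFG (u, u)
    rw [hPeq u hu u hu, hGdiag, Complex.norm_exp_ofReal_mul_I, Complex.ofReal_one, one_mul] at h1
    exact h1.symm
  · intro u v hu huv hv
    have h1 := hFG (u, v)
    rw [hPeq u ⟨hu, huv.le.trans hv⟩ v ⟨hu.trans huv.le, hv⟩] at h1
    rw [← hGchord, norm_mul, Complex.norm_real, Real.norm_of_nonneg (sub_pos.2 huv).le]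
    conv_lhs => rw [h1]
    push_cast
    ring

/-! ### Spirals: truncation, reflection and chord angles -/

namespace PlaneArc

/-- The arc with its curvature replaced by zero outside of the open interval `(0, S)`. -/
noncomputable def truncate (A : PlaneArc) : PlaneArc :=
  { A with curvature := (Ioo 0 A.length).indicator A.curvature }

/-- The mirror image of the arc in the real axis. -/
noncomputable def mirror (A : PlaneArc) : PlaneArc where
  length := A.length
  length_pos := A.length_pos
  curvature s := -A.curvature s
  startPoint := (starRingEnd ℂ) A.startPoint
  startAngle := -A.startAngle

theorem tangentAngle_truncate (A : PlaneArc) {s : ℝ} (hs : s ∈ Icc 0 A.length) :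
    A.truncate.tangentAngle s = A.tangentAngle s := by
  simp only [tangentAngle, truncate]
  rw [intervalIntegral.integral_of_le hs.1, intervalIntegral.integral_of_le hs.1,
    integral_Ioc_eq_integral_Ioo, integral_Ioc_eq_integral_Ioo]
  congr 1
  exact setIntegral_congr_fun measurableSet_Ioo fun t ht =>
    indicator_of_mem (show t ∈ Ioo 0 A.length from ⟨ht.1, ht.2.trans_le hs.2⟩) _

theorem point_truncate (A : PlaneArc) {s : ℝ} (hs : s ∈ Icc 0 A.length) :
    A.truncate.point s = A.point s := by
  simp only [point]
  refine congrArg₂ (· + ·) rfl (intervalIntegral.integral_congr fun t ht => ?_)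
  rw [uIcc_of_le hs.1] at ht
  simp only [A.tangentAngle_truncate ⟨ht.1, ht.2.trans hs.2⟩]

theorem integrable_curvature_truncate {A : PlaneArc}
    (hA : IntervalIntegrable A.curvature volume 0 A.length) :
    Integrable A.truncate.curvature := by
  refine (integrable_indicator_iff measurableSet_Ioo).2 ?_
  exact ((intervalIntegrable_iff_integrableOn_Ioc_of_le A.length_pos.le).1 hA).mono_set
    Ioo_subset_Ioc_self

theorem continuous_tangentAngle_truncate {A : PlaneArc}
    (hA : IntervalIntegrable A.curvature volume 0 A.length) :
    Continuous A.truncate.tangentAngle :=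
  continuous_const.add (intervalIntegral.continuous_primitive
    (fun _ _ => (integrable_curvature_truncate hA).intervalIntegrable) 0)

theorem hasDerivAt_point_truncate {A : PlaneArc}
    (hA : IntervalIntegrable A.curvature volume 0 A.length) (x : ℝ) :
    HasDerivAt A.truncate.point (Complex.exp (A.truncate.tangentAngle x * Complex.I)) x := by
  have h1 := continuous_tangentAngle_truncate hA
  have h2 : Continuous fun t => Complex.exp (A.truncate.tangentAngle t * Complex.I) := by fun_prop
  exact (intervalIntegral.integral_hasDerivAt_right (h2.intervalIntegrable _ _)
    h2.stronglyMeasurable.stronglyMeasurableAtFilter h2.continuousAt).const_add _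

theorem isRisingArc_truncate {A : PlaneArc} (hA : A.IsSpiral)
    (hmono : MonotoneOn A.curvature (Ioo 0 A.length)) :
    IsRisingArc A.length A.truncate.curvature A.truncate.tangentAngle A.truncate.point where
  pos := A.length_pos
  mono := fun s hs t ht hst => by
    simpa [truncate, indicator_of_mem hs, indicator_of_mem ht] using hmono hs ht hst
  integrable := fun _ _ => (integrable_curvature_truncate hA.integrable).intervalIntegrable
  continuous_angle := continuous_tangentAngle_truncate hA.integrable
  deriv_angle := by
    obtain ⟨F, hF, hcont⟩ := hA.piecewise_continuous
    -- Truncation may create jumps at the two endpoints.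
    refine ⟨F ∪ {0, A.length}, (hF.union (by simp)).countable, fun x hx => ?_⟩
    simp only [mem_union, mem_insert_iff, mem_singleton_iff, not_or] at hx
    have hint := integrable_curvature_truncate hA.integrable
    refine (intervalIntegral.integral_hasDerivAt_right hint.intervalIntegrable
      hint.aestronglyMeasurable.stronglyMeasurableAtFilter ?_).const_add _
    by_cases hxI : x ∈ Ioo 0 A.length
    · have hnhds : Ioo 0 A.length \ F ∈ nhds x :=
        (isOpen_Ioo.sdiff hF.isClosed).mem_nhds ⟨hxI, hx.1⟩
      refine (hcont.continuousAt hnhds).congr ?_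
      filter_upwards [hnhds] with t ht
      exact (indicator_of_mem ht.1 _).symm
    · have hxc : x ∈ (Icc 0 A.length)ᶜ := fun hxc =>
        hxI ⟨lt_of_le_of_ne hxc.1 (Ne.symm hx.2.1), lt_of_le_of_ne hxc.2 hx.2.2⟩
      refine (continuousAt_const (y := (0 : ℝ))).congr ?_
      filter_upwards [isClosed_Icc.isOpen_compl.mem_nhds hxc] with t ht
      exact (indicator_of_notMem (fun h => ht (Ioo_subset_Icc_self h)) _).symm
  deriv_point := hasDerivAt_point_truncate hA.integrable

theorem tangentAngle_mirror (A : PlaneArc) (s : ℝ) :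
    A.mirror.tangentAngle s = -A.tangentAngle s := by
  simp only [tangentAngle, mirror, intervalIntegral.integral_neg]
  ring

theorem point_mirror (A : PlaneArc) (s : ℝ) :
    A.mirror.point s = (starRingEnd ℂ) (A.point s) := by
  simp only [point, tangentAngle_mirror, map_add, ← intervalIntegral.intervalIntegral_conj,
    ← Complex.exp_conj]
  simp [mirror]

theorem IsSpiral.mirror {A : PlaneArc} (hA : A.IsSpiral) : A.mirror.IsSpiral where
  monotonic := hA.monotonic.symm.imp (fun h => h.neg) fun h => h.neg
  nonconstant := by
    obtain ⟨s, hs, t, ht, hst⟩ := hA.nonconstant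
    exact ⟨s, hs, t, ht, fun h => hst (neg_injective h)⟩
  piecewise_continuous := hA.piecewise_continuous.imp fun _ hF => ⟨hF.1, hF.2.neg⟩
  integrable := hA.integrable.neg
  no_circle := fun c r hr hsub => by
    refine hA.no_circle ((starRingEnd ℂ) c) r hr fun z hz => ?_
    have hz' : (starRingEnd ℂ) z ∈ Metric.sphere c r := by
      rw [mem_sphere_iff_norm] at hz ⊢
      rw [← hz, ← Complex.norm_conj (z - _)]
      simp
    obtain ⟨x, hx, hxz⟩ := hsub hz'
    rw [point_mirror] at hxz
    exact ⟨x, hx, (starRingEnd ℂ).injective hxz⟩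

theorem IsSpiral.injOn_of_monotoneOn {A : PlaneArc} (hA : A.IsSpiral)
    (hmono : MonotoneOn A.curvature (Ioo 0 A.length)) : InjOn A.point (Icc 0 A.length) := by
  have h := isRisingArc_truncate hA hmono
  refine InjOn.congr ?_ fun x hx => A.point_truncate hx
  by_contra hinj
  obtain ⟨a, b, c, ha, hab, hb, hZ, hk⟩ := h.exists_closed_subarc hinj
  obtain ⟨z, r, hr, hsub⟩ := exists_sphere_subset_image (c := c) hab (fun x hx => by
    rw [← sub_eq_iff_eq_add', ← h.integral_curvature hx.1, intervalIntegral.integral_of_le hx.1,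
      integral_Ioc_eq_integral_Ioo, setIntegral_congr_fun measurableSet_Ioo
      (fun t ht => hk t ⟨ht.1, ht.2.trans_le hx.2⟩)]
    simp [hx.1, mul_comm]) h.continuous_angle h.deriv_point hZ
  refine hA.no_circle z r hr (hsub.trans ?_)
  rintro _ ⟨x, hx, rfl⟩
  have hx' : x ∈ Icc 0 A.length := ⟨ha.trans hx.1, hx.2.trans hb⟩
  exact ⟨x, hx', (A.point_truncate hx').symm⟩

/-- A spiral has no self-intersections. -/
theorem IsSpiral.injOn {A : PlaneArc} (hA : A.IsSpiral) : InjOn A.point (Icc 0 A.length) := by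
  rcases hA.monotonic with hmono | hanti
  · exact hA.injOn_of_monotoneOn hmono
  · intro x hx y hy hxy
    exact hA.mirror.injOn_of_monotoneOn hanti.neg hx hy (by rw [point_mirror, point_mirror, hxy])

theorem IsSpiral.exists_isCumulativeChordAngle {A : PlaneArc} (hA : A.IsSpiral) :
    ∃ m, A.IsCumulativeChordAngle m := by
  obtain ⟨m, hm, hdiag, hchord⟩ := exists_continuous_chordAngle A.length_pos.le
    (continuous_tangentAngle_truncate hA.integrable) (hasDerivAt_point_truncate hA.integrable)
    (hA.injOn.congr fun x hx => (A.point_truncate hx).symm)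
  refine ⟨m, hm.continuousOn, fun u hu => ?_, fun u v hu huv hv => ?_⟩
  · rw [hdiag u hu, A.tangentAngle_truncate hu]
  · rw [← A.point_truncate ⟨hu, huv.le.trans hv⟩, ← A.point_truncate ⟨hu.trans huv.le, hv⟩]
    exact hchord u v hu huv hv

/-- Along the pairs `(0, v)` both functions are continuous arguments of the same nonzero chords, and
they agree at `v = 0` through the tangent angle. -/
theorem IsSpiral.chordAngle_unique {A : PlaneArc} (hA : A.IsSpiral) {m₁ m₂ : ℝ × ℝ → ℝ}
    (h₁ : A.IsCumulativeChordAngle m₁) (h₂ : A.IsCumulativeChordAngle m₂) :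
    m₁ (0, A.length) = m₂ (0, A.length) := by
  have h0 : (0 : ℝ) ∈ Icc 0 A.length := ⟨le_rfl, A.length_pos.le⟩
  have hcont : ∀ m, A.IsCumulativeChordAngle m →
      ContinuousOn (fun v => m (0, v)) (Icc 0 A.length) := fun m hm =>
    hm.continuousOn.comp (by fun_prop) fun v hv => ⟨le_rfl, hv.1, hv.2⟩
  have hdiag : m₁ (0, 0) = m₂ (0, 0) := by rw [h₁.diag 0 h0, h₂.diag 0 h0]
  refine eqOn_of_exp_mul_I_eq isPreconnected_Icc (hcont m₁ h₁) (hcont m₂ h₂) (fun v hv => ?_)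
    h0 hdiag ⟨A.length_pos.le, le_rfl⟩
  rcases hv.1.eq_or_lt with rfl | hv0
  · rw [hdiag]
  · have hne : (‖A.point v - A.point 0‖ : ℂ) ≠ 0 := by
      rw [Complex.ofReal_ne_zero, norm_ne_zero_iff, sub_ne_zero]
      exact fun e => hv0.ne' (hA.injOn hv h0 e)
    exact mul_left_cancel₀ hne
      ((h₁.chord 0 v le_rfl hv0 hv.2).symm.trans (h₂.chord 0 v le_rfl hv0 hv.2))

theorem IsCumulativeChordAngle.mirror {A : PlaneArc} {m : ℝ × ℝ → ℝ}
    (hm : A.IsCumulativeChordAngle m) : A.mirror.IsCumulativeChordAngle fun p => -m p where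
  continuousOn := hm.continuousOn.neg
  diag := fun u hu => by rw [tangentAngle_mirror, hm.diag u hu]
  chord := fun u v hu huv hv => by
    have := congrArg (starRingEnd ℂ) (hm.chord u v hu huv hv)
    rw [point_mirror, point_mirror, ← map_sub, Complex.norm_conj, this, map_mul,
      ← Complex.exp_conj]
    simp

/-- The bounds for the cumulative boundary angles of a spiral of increasing curvature. -/
theorem IsSpiral.boundaryAngle_bounds {A : PlaneArc} (hA : A.IsSpiral)
    (hmono : MonotoneOn A.curvature (Ioo 0 A.length)) {m : ℝ × ℝ → ℝ}
    (hm : A.IsCumulativeChordAngle m) :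
    0 < (A.tangentAngle 0 - m (0, A.length)) + (A.tangentAngle A.length - m (0, A.length)) ∧
      -Real.pi < A.tangentAngle 0 - m (0, A.length) ∧
      -Real.pi < A.tangentAngle A.length - m (0, A.length) ∧
      ((∀ t ∈ Ioo 0 A.length, 0 ≤ A.curvature t) → A.tangentAngle 0 - m (0, A.length) < 0) ∧
      ((∀ t ∈ Ioo 0 A.length, A.curvature t ≤ 0) →
        A.tangentAngle A.length - m (0, A.length) < 0) := by
  have hk : ∀ t ∈ Ioo 0 A.length, A.truncate.curvature t = A.curvature t := fun t ht =>
    indicator_of_mem ht _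
  obtain ⟨x, hx, y, hy, hxy, hlt⟩ : ∃ x ∈ Ioo 0 A.length, ∃ y ∈ Ioo 0 A.length, x < y ∧
      A.truncate.curvature x < A.truncate.curvature y := by
    obtain ⟨s, hs, t, ht, hst⟩ := hA.nonconstant
    rcases lt_or_gt_of_ne hst with hl | hl
    · exact ⟨s, hs, t, ht, hmono.reflect_lt hs ht hl, by rwa [hk s hs, hk t ht]⟩
    · exact ⟨t, ht, s, hs, hmono.reflect_lt ht hs hl, by rwa [hk s hs, hk t ht]⟩
  have := (isRisingArc_truncate hA hmono).boundaryAngle_bounds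
    (hA.injOn.congr fun x hx => (A.point_truncate hx).symm) hm.continuousOn
    (fun u hu => by rw [hm.diag u hu, A.tangentAngle_truncate hu])
    (fun u v hu huv hv => by
      rw [A.point_truncate ⟨hu, huv.le.trans hv⟩, A.point_truncate ⟨hu.trans huv.le, hv⟩]
      exact hm.chord u v hu huv hv) hx hy hxy hlt
  rw [A.tangentAngle_truncate ⟨le_rfl, A.length_pos.le⟩,
    A.tangentAngle_truncate ⟨A.length_pos.le, le_rfl⟩] at this
  refine ⟨this.1, this.2.1, this.2.2.1, fun h => this.2.2.2.1 fun t ht => ?_,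
    fun h => this.2.2.2.2 fun t ht => ?_⟩
  · rw [hk t ht]
    exact h t ht
  · rw [hk t ht]
    exact h t ht

/-! ### From boundary angles to the winding angle -/

theorem windingAngle_eq (A : PlaneArc) :
    A.windingAngle = A.tangentAngle A.length - A.tangentAngle 0 := by
  simp [windingAngle, tangentAngle]

theorem nonneg_or_nonpos_of_not_hasInflection {A : PlaneArc} (h : ¬ A.HasInflection) :
    (∀ t ∈ Ioo 0 A.length, 0 ≤ A.curvature t) ∨ ∀ t ∈ Ioo 0 A.length, A.curvature t ≤ 0 := by
  by_contra! hcon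
  obtain ⟨⟨s, hs, hs0⟩, t, ht, ht0⟩ := hcon
  exact h ⟨s, hs, t, ht, hs0, ht0⟩

theorem IsSpiral.abs_windingAngle_bounds_of_monotoneOn {A : PlaneArc} (hA : A.IsSpiral)
    (hmono : MonotoneOn A.curvature (Ioo 0 A.length)) {w : ℝ} (hw : A.IsVogtAngle w) :
    |A.windingAngle| < 2 * |w| + 2 * Real.pi ∧
      (¬ A.HasInflection → 0 < 2 * |w| ∧ 2 * |w| < |A.windingAngle|) := by
  obtain ⟨m, hm, hwm⟩ := hw
  obtain ⟨h1, h2, h3, h4, h5⟩ := hA.boundaryAngle_bounds hmono hm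
  have hw0 : 0 < w := by linarith
  rw [windingAngle_eq, abs_of_pos hw0]
  -- The lower bound on the winding angle uses that the final boundary angle exceeds `-π`, the upper
  -- bound that the initial one does.
  refine ⟨abs_lt.2 ⟨by linarith, by linarith⟩, fun hinf => ⟨by linarith, ?_⟩⟩
  rw [lt_abs]
  rcases nonneg_or_nonpos_of_not_hasInflection hinf with hk | hk
  · exact Or.inl (by linarith [h4 hk])
  · exact Or.inr (by linarith [h5 hk])

theorem IsVogtAngle.mirror {A : PlaneArc} {w : ℝ} (hw : A.IsVogtAngle w) :
    A.mirror.IsVogtAngle (-w) := by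
  obtain ⟨m, hm, rfl⟩ := hw
  refine ⟨_, hm.mirror, ?_⟩
  rw [tangentAngle_mirror, tangentAngle_mirror]
  simp only [PlaneArc.mirror]
  ring

theorem windingAngle_mirror (A : PlaneArc) : A.mirror.windingAngle = -A.windingAngle := by
  simp [windingAngle, mirror]

theorem HasInflection.of_mirror {A : PlaneArc} (h : A.mirror.HasInflection) :
    A.HasInflection := by
  obtain ⟨s, hs, t, ht, hs0, ht0⟩ := h
  exact ⟨t, ht, s, hs, neg_pos.1 ht0, neg_lt_zero.1 hs0⟩

theorem IsSpiral.abs_windingAngle_bounds {A : PlaneArc} (hA : A.IsSpiral) {w : ℝ}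
    (hw : A.IsVogtAngle w) :
    |A.windingAngle| < 2 * |w| + 2 * Real.pi ∧
      (¬ A.HasInflection → 0 < 2 * |w| ∧ 2 * |w| < |A.windingAngle|) := by
  rcases hA.monotonic with hmono | hanti
  · exact hA.abs_windingAngle_bounds_of_monotoneOn hmono hw
  · have := hA.mirror.abs_windingAngle_bounds_of_monotoneOn hanti.neg hw.mirror
    rw [windingAngle_mirror, abs_neg, abs_neg] at this
    exact ⟨this.1, fun h => this.2 fun h' => h h'.of_mirror⟩

end PlaneArc

/-- A spiral has a well-defined Vogt angle `w`, and its winding angle is bounded in terms of it. -/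
theorem corollary5p11 (A : PlaneArc) (hA : A.IsSpiral) :
    (∃! w : ℝ, A.IsVogtAngle w) ∧
    ∀ w : ℝ, A.IsVogtAngle w →
      |A.windingAngle| < 2 * |w| + 2 * Real.pi ∧
      (¬ A.HasInflection →
        0 < 2 * |w| ∧ 2 * |w| < |A.windingAngle| ∧
          |A.windingAngle| < 2 * |w| + 2 * Real.pi) := by
  obtain ⟨m, hm⟩ := hA.exists_isCumulativeChordAngle
  refine ⟨⟨_, ⟨m, hm, rfl⟩, ?_⟩, fun w hw => ?_⟩
  · rintro _ ⟨m', hm', rfl⟩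
    rw [hA.chordAngle_unique hm' hm]
  · obtain ⟨h1, h2⟩ := hA.abs_windingAngle_bounds hw
    exact ⟨h1, fun h => ⟨(h2 h).1, (h2 h).2, h1⟩⟩
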